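/- Let $X$ be a topological space with basepoint $x_0$. For $n\ge 1$ let $\tau_n(X,x_0)=\pi_1\bigl(X^{T^{n-1}},\overline{x_0}\bigr)$ be the $n$-th Fox torus homotopy group, where $T^{n-1}$ is the $(n-1)$-dimensional torus ($T^0$ is a point), $X^{T^{n-1}}$ is the space of all unbased continuous maps $T^{n-1}\to X$ with the compact-open topology, and $\overline{x_0}$ is the constant map at $x_0$. Let $\pi_n(X,x_0)\to\tau_n(X,x_0)$ be the canonical homomorphism $$\pi_n(X,x_0)\cong\pi_1(\Omega^{n-1}X,\overline{x_0})\longrightarrow\pi_1\bigl(X^{T^{n-1}},\overline{x_0}\bigr)=\tau_n(X,x_0)$$ induced by composing maps $(I^{n-1},\partial I^{n-1})\to (X,x_0)$ with the pinch map $T^{n-1}\to I^{n-1}/\partial I^{n-1}$. Then: (1) For every $n$, one has $\tau_k(X,x_0)=1$ for all $1\le k\le n$ if and only if $\pi_k(X,x_0)=1$ for all $1\le k\le n$. (2) For every $n\ge 1$, the canonical homomorphism $\pi_n(X,x_0)\to\tau_n(X,x_0)$ is an isomorphism if and only if $\pi_k(X,x_0)=1$ for all $1\le k\le n-1$. In particular,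 if $X$ is path-connected, it is an isomorphism if and only if $X$ is $(n-1)$-connected (that is, path-connected with $\pi_k(X,x)=1$ for all $1\le k\le n-1$ and all $x \in X$). -/

import Mathlib

open scoped unitInterval Topology Topology.Homotopy

noncomputable section

namespace Fox

/-- The torus `T^N`, a product of circles `ℝ / ℤ` indexed by `N`.
The `m`-torus is `Torus (Fin m)`; `Torus (Fin 0)` is a point. -/
abbrev Torus (N : Type) : Type := N → UnitAddCircle

/-- The `n`-th torus homotopy group `τ_n(X, x₀) = π₁(X^{T^{n-1}}, const x₀)`, for `n ≥ 1`.
Here `C(Torus (Fin (n - 1)), X)` is the space of all (unbased) continuous maps `T^{n-1} → X` with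
the compact-open topology. (The value at `n = 0` is meaningless and never used.) -/
abbrev TorusHomotopyGroup (n : ℕ) (X : Type*) [TopologicalSpace X] (x₀ : X) : Type _ :=
  FundamentalGroup C(Torus (Fin (n - 1)), X) (ContinuousMap.const _ x₀)

/-- A space is `m`-connected if it is (nonempty and) path-connected and its homotopy groups `π_k`
vanish for `1 ≤ k ≤ m`, at every base point. -/
def IsNConnected (m : ℕ) (X : Type*) [TopologicalSpace X] : Prop :=
  PathConnectedSpace X ∧ ∀ (x : X) (k : ℕ), 1 ≤ k → k ≤ m → Subsingleton (π_ k X x)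

section Collapse

variable (N : Type)

/-- The quotient map `I^N → T^N` identifying opposite faces of the cube. -/
def cubeToTorus : C(I^N, Torus N) where
  toFun t i := ((t i : ℝ) : UnitAddCircle)
  continuous_toFun := by
    refine continuous_pi fun i => ?_
    exact (AddCircle.continuous_mk' (1 : ℝ)).comp
      (continuous_subtype_val.comp (continuous_apply i))

theorem cubeToTorus_apply (t : I^N) (i : N) :
    cubeToTorus N t i = ((t i : ℝ) : UnitAddCircle) := rfl

theorem cubeToTorus_surjective : Function.Surjective (cubeToTorus N) := by
  intro z
  have h : ∀ i, ∃ s : I, ((s : ℝ) : UnitAddCircle) = z i := by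
    intro i
    have hz : z i ∈ ((↑) : ℝ → UnitAddCircle) '' Set.Icc 0 (0 + 1) := by
      rw [AddCircle.coe_image_Icc_eq]; trivial
    obtain ⟨s, hs, hsz⟩ := hz
    exact ⟨⟨s, hs.1, by simpa using hs.2⟩, hsz⟩
  choose s hs using h
  exact ⟨s, funext hs⟩

theorem isQuotientMap_cubeToTorus : Topology.IsQuotientMap (cubeToTorus N) :=
  ((cubeToTorus N).continuous.isClosedMap).isQuotientMap (cubeToTorus N).continuous
    (cubeToTorus_surjective N)

variable {N}

theorem mem_boundary_of_cubeToTorus_eq {s t : I^N} (h : cubeToTorus N s = cubeToTorus N t)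
    (hne : s ≠ t) : s ∈ Cube.boundary N := by
  obtain ⟨i, hi⟩ := Function.ne_iff.1 hne
  refine ⟨i, ?_⟩
  by_contra hb
  push Not at hb
  have hs0 : (0 : ℝ) < s i := lt_of_le_of_ne (s i).2.1 fun e => hb.1 (Subtype.ext e.symm)
  have hs1 : (s i : ℝ) < 1 := lt_of_le_of_ne (s i).2.2 fun e => hb.2 (Subtype.ext e)
  have hi' : ((s i : ℝ) : UnitAddCircle) = ((t i : ℝ) : UnitAddCircle) := congrFun h i
  apply hi
  apply Subtype.ext
  rcases eq_or_lt_of_le (t i).2.2 with ht | ht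
  · refine (AddCircle.coe_eq_coe_iff_of_mem_Ioc (p := (1 : ℝ)) (a := 0)
      ⟨hs0, by linarith⟩ ⟨by rw [ht]; norm_num, by rw [ht]; norm_num⟩).1 hi'
  · exact (AddCircle.coe_eq_coe_iff_of_mem_Ico (p := (1 : ℝ)) (a := 0)
      ⟨hs0.le, by linarith⟩ ⟨(t i).2.1, by linarith⟩).1 hi'

variable {X : Type*} [TopologicalSpace X] {x₀ : X}

theorem genLoop_const_on_fibers (f : Ω^ N X x₀) (s t : I^N)
    (h : cubeToTorus N s = cubeToTorus N t) : f.1 s = f.1 t := by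
  by_cases hne : s = t
  · rw [hne]
  · rw [f.2 s (mem_boundary_of_cubeToTorus_eq h hne),
      f.2 t (mem_boundary_of_cubeToTorus_eq h.symm (Ne.symm hne))]

/-- A map of the cube sending its boundary to `x₀`, regarded as a map on the torus.  In other
words, this is precomposition with the pinch map `T^N → T^N / (fat wedge) = I^N / ∂ I^N`. -/
def genLoopToTorusMap (f : Ω^ N X x₀) : C(Torus N, X) :=
  (isQuotientMap_cubeToTorus N).lift f.1 fun s t h => genLoop_const_on_fibers f s t h

theorem genLoopToTorusMap_apply (f : Ω^ N X x₀) (t : I^N) :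
    genLoopToTorusMap f (cubeToTorus N t) = f t :=
  ContinuousMap.congr_fun ((isQuotientMap_cubeToTorus N).lift_comp f.1
    fun s t h => genLoop_const_on_fibers f s t h) t

theorem continuous_genLoopToTorusMap :
    Continuous (genLoopToTorusMap : Ω^ N X x₀ → C(Torus N, X)) := by
  refine ContinuousMap.continuous_compactOpen.2 fun K hK U hU => ?_
  have hK' : IsCompact (cubeToTorus N ⁻¹' K) :=
    (hK.isClosed.preimage (cubeToTorus N).continuous).isCompact
  convert (ContinuousMap.isOpen_setOfPred_mapsTo (Y := X) hK' hU).preimage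
    (continuous_subtype_val : Continuous (Subtype.val : Ω^ N X x₀ → C(I^N, X))) using 1
  ext f
  constructor
  · intro hf s hs
    have := hf hs
    rwa [genLoopToTorusMap_apply] at this
  · intro hf z hz
    obtain ⟨s, rfl⟩ := cubeToTorus_surjective N z
    rw [genLoopToTorusMap_apply]
    exact hf hz

theorem genLoopToTorusMap_const :
    genLoopToTorusMap (GenLoop.const : Ω^ N X x₀) = ContinuousMap.const _ x₀ := by
  ext z
  obtain ⟨s, rfl⟩ := cubeToTorus_surjective N z
  rw [genLoopToTorusMap_apply]
  rfl

end Collapse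

section CanonicalMap

variable (m : ℕ) (X : Type*) [TopologicalSpace X] (x₀ : X)

/-- The isomorphism `π_{m+1}(X, x₀) ≅ π₁(Ω^m X, const)`, the loop coordinate being the first
coordinate of the cube. -/
def piEquivPi1GenLoop :
    π_ (m + 1) X x₀ ≃*
      FundamentalGroup (Ω^ { j : Fin (m + 1) // j ≠ 0 } X x₀) GenLoop.const where
  toEquiv := homotopyGroupEquivFundamentalGroup (0 : Fin (m + 1))
  map_mul' a b := by
    induction a using Quotient.inductionOn with | _ p =>
    induction b using Quotient.inductionOn with | _ q =>
    refine (congrArg (homotopyGroupEquivFundamentalGroup (0 : Fin (m + 1)))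
      (HomotopyGroup.mul_spec (i := 0) (p := p) (q := q))).trans ?_
    rw [← GenLoop.fromLoop_trans_toLoop]
    change (⟦GenLoop.toLoop 0 (GenLoop.fromLoop 0 _)⟧ : Path.Homotopic.Quotient _ _) = _
    rw [GenLoop.to_from]
    rfl

/-- The map `Ω^m X → X^{T^m}` (with the coordinates other than the first renumbered `0, …, m-1`,
in order). -/
def loopsToTorusMaps : C(Ω^ { j : Fin (m + 1) // j ≠ 0 } X x₀, C(Torus (Fin m), X)) where
  toFun f := genLoopToTorusMap (GenLoop.congr x₀ (finSuccAboveEquiv (0 : Fin (m + 1))).symm f)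
  continuous_toFun := continuous_genLoopToTorusMap.comp
    (GenLoop.congr x₀ (finSuccAboveEquiv (0 : Fin (m + 1))).symm).continuous

theorem loopsToTorusMaps_const :
    loopsToTorusMaps m X x₀ GenLoop.const = ContinuousMap.const _ x₀ :=
  genLoopToTorusMap_const

/-- The canonical homomorphism `π_{m+1}(X, x₀) → τ_{m+1}(X, x₀)`, that is,
`π_{m+1}(X, x₀) ≅ π₁(Ω^m X, const) → π₁(X^{T^m}, const)`, the second map being induced by
`Ω^m X → X^{T^m}`. -/
def piToTau : π_ (m + 1) X x₀ →* TorusHomotopyGroup (m + 1) X x₀ :=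
  (FundamentalGroup.mapOfEq (loopsToTorusMaps m X x₀) (loopsToTorusMaps_const m X x₀)).comp
    (piEquivPi1GenLoop m X x₀).toMonoidHom

end CanonicalMap

end Fox

end

noncomputable section

namespace Fox

open ContinuousMap Function

/-! ### Homotopies through constrained maps -/

section Homotopy

variable {A X : Type*} [TopologicalSpace A] [TopologicalSpace X]

/-! An element of τ_{m+1} is a map on the cube I^{m+1} that is periodic in every direction and equal
to x₀ on the two faces in direction 0. It comes from π_{m+1} when it can be made constant on all
faces, so everything is a question of gaining or losing face conditions one direction at a time
(`IsTorusMap`).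

Losing them loses nothing. By `homotopicWith_const_insert`, if a map constant on the faces in
direction i contracts through maps that are only periodic there, the motion of those faces can be
cancelled against itself. Hence π → τ is always injective.

Gaining them is homotopy extension: by `exists_homotopicWith_insert`, a contraction of the face t_i
= 0 can be spread over collars of both faces. That face is a periodic map in fewer variables, so by
induction it contracts when the lower π_k vanish; this gives surjectivity.

Conversely, pull p ∈ π_k with k ≤ m back to I^{m+1} along a projection. If the result comes from
π_{m+1}, restricting the homotopy to the face where the added coordinates are 0 contracts p.

Part (1) follows from injectivity one way and surjectivity the other. -/

theorem homotopicWith_of_continuous {f g : C(A, X)} {P : C(A, X) → Prop} (H : I → A → X)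
    (hH : Continuous fun q : I × A => H q.1 q.2) (h0 : ∀ t, H 0 t = f t) (h1 : ∀ t, H 1 t = g t)
    (hP : ∀ (s : I) (h : C(A, X)), (∀ t, h t = H s t) → P h) : HomotopicWith f g P :=
  ⟨{ toFun := fun q => H q.1 q.2
     continuous_toFun := hH
     map_zero_left := h0
     map_one_left := h1
     prop' := fun s => hP s _ fun _ => rfl }⟩

theorem _root_.ContinuousMap.HomotopicWith.exists_map {f g : C(A, X)} {P : C(A, X) → Prop}
    (h : HomotopicWith f g P) : ∃ H : I → A → X, Continuous (fun q : I × A => H q.1 q.2) ∧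
      (∀ t, H 0 t = f t) ∧ (∀ t, H 1 t = g t) ∧
      ∀ s, ∃ h : C(A, X), (∀ t, h t = H s t) ∧ P h := by
  obtain ⟨F⟩ := h
  exact ⟨fun s t => F (s, t), F.continuous, F.apply_zero, F.apply_one,
    fun s => ⟨_, fun _ => rfl, F.prop' s⟩⟩

/-- Homotopies with a property can be transported by a precomposition. -/
theorem _root_.ContinuousMap.HomotopicWith.comp_right {B : Type*} [TopologicalSpace B]
    {f g : C(A, X)} {P : C(A, X) → Prop} (h : HomotopicWith f g P) (r : C(B, A))
    {Q : C(B, X) → Prop} (hQ : ∀ h : C(A, X), P h → Q (h.comp r)) :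
    HomotopicWith (f.comp r) (g.comp r) Q := by
  obtain ⟨H, hH, h0, h1, hP⟩ := h.exists_map
  refine homotopicWith_of_continuous (fun s t => H s (r t)) (by fun_prop) (fun t => h0 _)
    (fun t => h1 _) fun s k hk => ?_
  obtain ⟨l, hl, hl'⟩ := hP s
  convert hQ l hl'
  ext t
  rw [hk, ContinuousMap.comp_apply, hl]

theorem _root_.ContinuousMap.HomotopicWith.mono {f g : C(A, X)} {P Q : C(A, X) → Prop}
    (h : HomotopicWith f g P) (hPQ : ∀ h, P h → Q h) : HomotopicWith f g Q :=
  h.comp_right (ContinuousMap.id A) fun k hk => hPQ k hk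

end Homotopy

/-- The coordinates of `t` are replaced by those of `t'` one at a time. -/
theorem apply_eq_of_update {N A X : Type*} [Finite N] [DecidableEq N] {f : (N → A) → X}
    {R : N → A → A → Prop}
    (hf : ∀ t i a b, R i a b → f (update t i a) = f (update t i b)) {t t' : N → A}
    (h : ∀ i, R i (t i) (t' i)) : f t = f t' := by
  classical
  cases nonempty_fintype N
  have key : ∀ E : Finset N, f (fun i => if i ∈ E then t' i else t i) = f t := by
    intro E
    induction E using Finset.induction_on with
    | empty => simp
    | insert a E ha ih =>
      rw [← ih]
      have h1 : (fun i => if i ∈ insert a E then t' i else t i) =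
          update (fun i => if i ∈ E then t' i else t i) a (t' a) := by
        ext i
        by_cases hi : i = a
        · subst hi; simp
        · simp [hi]
      have h2 : (fun i => if i ∈ E then t' i else t i) =
          update (fun i => if i ∈ E then t' i else t i) a (t a) := by
        ext i
        by_cases hi : i = a
        · subst hi; simp [ha]
        · simp [hi]
      rw [h1]
      conv_rhs => rw [h2]
      exact (hf _ _ _ _ (h a)).symm
  simpa using (key Finset.univ).symm

/-! ### Deforming periodic maps of a cube -/

section Cube

variable {N : Type*} [DecidableEq N] {X : Type*} [TopologicalSpace X]

/-- The maps of a cube that are constant on the faces in the directions of `S`, take equal values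
on opposite faces, and do not depend on the coordinates in `D`. -/
structure IsTorusMap (x₀ : X) (S D : Finset N) (f : C(I^N, X)) : Prop where
  face : ∀ t, ∀ i ∈ S, t i = 0 ∨ t i = 1 → f t = x₀
  periodic : ∀ t i, f (update t i 0) = f (update t i 1)
  indep : ∀ t, ∀ i ∈ D, ∀ a, f (update t i a) = f t

namespace IsTorusMap

variable {x₀ : X} {S D : Finset N} {f : C(I^N, X)}

theorem mono (h : IsTorusMap x₀ S D f) {S' D' : Finset N} (hS : S' ⊆ S) (hD : D' ⊆ D) :
    IsTorusMap x₀ S' D' f :=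
  ⟨fun t i hi => h.face t i (hS hi), h.periodic, fun t i hi => h.indep t i (hD hi)⟩

theorem apply_eq_of_eq_off [Finite N] (h : IsTorusMap x₀ S D f) {t t' : I^N}
    (ht : ∀ i ∉ D, t i = t' i) : f t = f t' := by
  refine apply_eq_of_update (R := fun i a b => i ∉ D → a = b) (fun t i a b hab => ?_) ht
  by_cases hi : i ∈ D
  · rw [h.indep t i hi, h.indep t i hi]
  · rw [hab hi]

end IsTorusMap

/-- The map `I → I` with value `0` at `0` and `1`, and `1` on the middle third. -/
def tent (u : I) : I := Set.projIcc 0 1 zero_le_one (min (3 * u) (3 - 3 * u) : ℝ)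

theorem continuous_tent : Continuous tent := by
  unfold tent
  exact continuous_projIcc.comp (by fun_prop)

theorem tent_zero : tent 0 = 0 := by
  ext; simp [tent, Set.projIcc]

theorem tent_one : tent 1 = 0 := by
  ext; simp [tent, Set.projIcc]

/-- The map `I → I` that stretches the interval by the factor `1 + 2 * s` about its midpoint. -/
def stretch (s u : I) : I := Set.projIcc 0 1 zero_le_one (u + s * (2 * u - 1) : ℝ)

theorem continuous_stretch : Continuous fun q : I × I => stretch q.1 q.2 := by
  unfold stretch
  exact continuous_projIcc.comp (by fun_prop)

theorem stretch_zero_left (u : I) : stretch 0 u = u := by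
  simp [stretch]

theorem stretch_zero_right (s : I) : stretch s 0 = 0 := by
  ext; simp [stretch, Set.projIcc, s.2.1]

theorem stretch_one_right (s : I) : stretch s 1 = 1 := by
  have := s.2.1
  have h : (1 : ℝ) ≤ 1 + s * (2 * 1 - 1) := by linarith
  simp only [stretch, Set.Icc.coe_one]
  exact Set.projIcc_of_right_le _ h

theorem tent_cases (u : I) : tent u = 1 ∨ stretch 1 u = 0 ∨ stretch 1 u = 1 := by
  by_cases h1 : (u : ℝ) ≤ 1 / 3
  · right; left
    refine Set.projIcc_of_le_left _ ?_
    simp only [Set.Icc.coe_one]; linarith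
  by_cases h2 : (2 : ℝ) / 3 ≤ u
  · right; right
    refine Set.projIcc_of_right_le _ ?_
    simp only [Set.Icc.coe_one]; linarith
  · left
    refine Set.projIcc_of_right_le _ (le_min ?_ ?_) <;> linarith

/-- A map that is constant on the faces in direction `i` and that can be contracted through
maps which are merely periodic in direction `i` can be contracted keeping those faces fixed. -/
theorem homotopicWith_const_insert {x₀ : X} {S D : Finset N} {i : N} (hi : i ∉ D) {f : C(I^N, X)}
    (hf : IsTorusMap x₀ (insert i S) D f)
    (h : HomotopicWith f (.const _ x₀) (IsTorusMap x₀ S D)) :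
    HomotopicWith f (.const _ x₀) (IsTorusMap x₀ (insert i S) D) := by
  obtain ⟨H, hH, h0, h1, hP⟩ := h.exists_map
  have face : ∀ s t, ∀ j ∈ S, t j = 0 ∨ t j = 1 → H s t = x₀ := fun s t j hj hjt => by
    obtain ⟨k, hk, hk'⟩ := hP s
    rw [← hk]; exact hk'.face t j hj hjt
  have per : ∀ s t j, H s (update t j 0) = H s (update t j 1) := fun s t j => by
    obtain ⟨k, hk, hk'⟩ := hP s
    rw [← hk, ← hk]; exact hk'.periodic t j
  have indep : ∀ s t, ∀ j ∈ D, ∀ a, H s (update t j a) = H s t := fun s t j hj a => by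
    obtain ⟨k, hk, hk'⟩ := hP s
    rw [← hk, ← hk]; exact hk'.indep t j hj a
  have hf0 : ∀ t a, a = 0 ∨ a = 1 → f (update t i a) = x₀ := fun t a ha =>
    hf.face _ i (Finset.mem_insert_self _ _) (by simpa using ha)
  -- a homotopy `q.1 ↦ H (α q.1 (t i)) (update t i (β q.1 (t i)))`
  have key : ∀ (α β : I → I → I), (∀ s, α s 0 = 0) → (∀ s, α s 1 = 0) →
      (∀ s, β s 0 = 0 ∨ β s 0 = 1) → (∀ s, β s 1 = 0 ∨ β s 1 = 1) →
      ∀ (s : I) (k : C(I^N, X)), (∀ t, k t = H (α s (t i)) (update t i (β s (t i)))) →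
      IsTorusMap x₀ (insert i S) D k := by
    intro α β hα0 hα1 hβ0 hβ1 s k hk
    have hk0 : ∀ t, t i = 0 ∨ t i = 1 → k t = x₀ := by
      intro t ht
      rw [hk]
      rcases ht with ht | ht
      · rw [ht, hα0, h0, hf0 _ _ (hβ0 s)]
      · rw [ht, hα1, h0, hf0 _ _ (hβ1 s)]
    have hne : ∀ t j a, j ≠ i → k (update t j a) =
        H (α s (t i)) (update (update t i (β s (t i))) j a) := by
      intro t j a hj
      rw [hk, update_of_ne (Ne.symm hj), update_comm (Ne.symm hj)]
    refine ⟨fun t j hj hjt => ?_, fun t j => ?_, fun t j hj a => ?_⟩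
    · by_cases hji : j = i
      · subst hji; exact hk0 t hjt
      · rw [hk]
        refine face _ _ j (Finset.mem_of_mem_insert_of_ne hj hji) ?_
        rwa [update_of_ne hji]
    · by_cases hji : j = i
      · subst hji
        rw [hk0 _ (by simp), hk0 _ (by simp)]
      · rw [hne _ _ _ hji, hne _ _ _ hji, per]
    · have hji : j ≠ i := fun e => hi (e ▸ hj)
      rw [hne _ _ _ hji, indep _ _ j hj, hk]
  have hst := continuous_stretch
  have htt := continuous_tent
  -- `g` only sees the track of the face t_i = 0 under `H`, run forwards and then backwards as t_i
  -- crosses the cube.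
  let g : C(I^N, X) := ⟨fun t => H (tent (t i)) (update t i 0),
    hH.comp (g := fun q : I × (I^N) => H q.1 q.2)
      ((htt.comp (continuous_apply i)).prodMk (continuous_id.update i continuous_const))⟩
  -- At time 1 the middle third already sits in the constant map `H 1`. On the outer thirds `stretch
  -- 1` is 0 or 1, and periodicity identifies the two faces, so both tracks are the same.
  have step1 : HomotopicWith f g (IsTorusMap x₀ (insert i S) D) := by
    refine homotopicWith_of_continuous
      (fun s t => H (s * tent (t i)) (update t i (stretch s (t i)))) ?_ ?_ ?_ ?_
    · refine hH.comp (g := fun q : I × (I^N) => H q.1 q.2) (Continuous.prodMk ?_ ?_)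
      · exact continuous_fst.mul (htt.comp (by fun_prop))
      · exact continuous_snd.update i (hst.comp (f := fun q : I × (I^N) => (q.1, q.2 i))
          (by fun_prop))
    · intro t
      simp only [zero_mul, stretch_zero_left, update_eq_self, h0]
    · intro t
      simp only [one_mul, g, ContinuousMap.coe_mk]
      rcases tent_cases (t i) with h | h | h
      · rw [h, h1, h1]; rfl
      · rw [h]
      · rw [h, per]
    · exact key (fun s u => s * tent u) stretch (by simp [tent_zero]) (by simp [tent_one])
        (by simp [stretch_zero_right]) (by simp [stretch_one_right])
  -- The excursion along the track is now shortened to nothing, which leaves `f` on its face t_i =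
  -- 0, where it is x₀.
  refine step1.trans ?_
  refine homotopicWith_of_continuous
      (fun s t => H (σ s * tent (t i)) (update t i 0)) ?_ ?_ ?_ ?_
  · refine hH.comp (g := fun q : I × (I^N) => H q.1 q.2) (Continuous.prodMk ?_ ?_)
    · exact (unitInterval.continuous_symm.comp continuous_fst).mul (htt.comp (by fun_prop))
    · exact continuous_snd.update i continuous_const
  · intro t
    simp [g]
  · intro t
    simp only [unitInterval.symm_one, zero_mul, h0]
    exact hf0 _ _ (Or.inl rfl)
  · exact key (fun s u => σ s * tent u) (fun _ _ => 0) (by simp [tent_zero]) (by simp [tent_one])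
      (by simp) (by simp)

/-- Restriction to the face `t i = 0`, regarded again as a map on the whole cube. -/
def faceZero (i : N) (f : C(I^N, X)) : C(I^N, X) :=
  ⟨fun t => f (update t i 0), f.continuous.comp (continuous_id.update i continuous_const)⟩

theorem IsTorusMap.faceZero {x₀ : X} {S D : Finset N} {f : C(I^N, X)} (hf : IsTorusMap x₀ S D f)
    {i : N} (hi : i ∉ S) : IsTorusMap x₀ S (insert i D) (faceZero i f) := by
  refine ⟨fun t j hj hjt => ?_, fun t j => ?_, fun t j hj a => ?_⟩ <;>
    simp only [Fox.faceZero, ContinuousMap.coe_mk]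
  · refine hf.face _ j hj ?_
    rwa [update_of_ne (ne_of_mem_of_not_mem hj hi)]
  · by_cases hji : j = i
    · subst hji; simp
    · rw [update_comm hji, update_comm hji, hf.periodic]
  · by_cases hji : j = i
    · subst hji; simp
    · rw [update_comm hji, hf.indep _ j (Finset.mem_of_mem_insert_of_ne hj hji)]

/-- If the face `t i = 0` of a periodic map can be contracted, then the map can be deformed into
one that is constant on the faces in direction `i`. -/
theorem exists_homotopicWith_insert {x₀ : X} {S D : Finset N} {i : N} (hi : i ∉ S) (hi' : i ∉ D)
    {f : C(I^N, X)} (hf : IsTorusMap x₀ S D f)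
    (h : HomotopicWith (faceZero i f) (.const _ x₀) (IsTorusMap x₀ S (insert i D))) :
    ∃ g, IsTorusMap x₀ (insert i S) D g ∧ HomotopicWith f g (IsTorusMap x₀ S D) := by
  obtain ⟨K, hK, h0, h1, hP⟩ := h.exists_map
  have face : ∀ s t, ∀ j ∈ S, t j = 0 ∨ t j = 1 → K s t = x₀ := fun s t j hj hjt => by
    obtain ⟨k, hk, hk'⟩ := hP s
    rw [← hk]; exact hk'.face t j hj hjt
  have per : ∀ s t j, K s (update t j 0) = K s (update t j 1) := fun s t j => by
    obtain ⟨k, hk, hk'⟩ := hP s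
    rw [← hk, ← hk]; exact hk'.periodic t j
  have indep : ∀ s t, ∀ j ∈ insert i D, ∀ a, K s (update t j a) = K s t := fun s t j hj a => by
    obtain ⟨k, hk, hk'⟩ := hP s
    rw [← hk, ← hk]; exact hk'.indep t j hj a
  -- `v` is the stretched coordinate before clamping and `e` measures how far it leaves [0, 1].
  -- Inside, `H` is the stretched `f`; outside, it runs the contraction `K` for time `e`. On the
  -- faces in direction i, `e` equals `s`, so `H s` is `K s` there.
  let v : I → I → ℝ := fun s u => u + s * (2 * u - 1)
  let e : I → I → ℝ := fun s u => max (-(v s u)) (v s u - 1)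
  let E : I → I → I := fun s u => Set.projIcc 0 1 zero_le_one (e s u)
  let H : I → (I^N) → X := fun s t =>
    if e s (t i) ≤ 0 then f (update t i (stretch s (t i))) else K (E s (t i)) t
  have hv : Continuous fun q : I × (I^N) => v q.1 (q.2 i) := by fun_prop
  have he : Continuous fun q : I × (I^N) => e q.1 (q.2 i) := by fun_prop
  have hE : Continuous fun q : I × (I^N) => E q.1 (q.2 i) := continuous_projIcc.comp he
  have hH : Continuous fun q : I × (I^N) => H q.1 q.2 := by
    refine Continuous.if_le ?_ ?_ he continuous_const ?_
    · exact f.continuous.comp (continuous_snd.update i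
        (continuous_stretch.comp (f := fun q : I × (I^N) => (q.1, q.2 i)) (by fun_prop)))
    · exact hK.comp (g := fun q : I × (I^N) => K q.1 q.2) (hE.prodMk continuous_snd)
    · rintro ⟨s, t⟩ hq
      simp only at hq ⊢
      have hE0 : E s (t i) = 0 := by simp only [E, hq]; exact Set.projIcc_left _
      rw [hE0, h0]
      have : stretch s (t i) = 0 ∨ stretch s (t i) = 1 := by
        rcases max_choice (-(v s (t i))) (v s (t i) - 1) with hm | hm
        · left
          refine Set.projIcc_of_le_left _ (?_ : v s (t i) ≤ 0)
          have : e s (t i) = _ := hm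
          linarith
        · right
          refine Set.projIcc_of_right_le _ (?_ : 1 ≤ v s (t i))
          have : e s (t i) = _ := hm
          linarith
      rcases this with h | h
      · rw [h]; rfl
      · rw [h, ← hf.periodic]; rfl
  have hside : ∀ s t, t i = 0 ∨ t i = 1 → H s t = K s t := by
    intro s t ht
    have hs := s.2.1
    have hes : e s (t i) = s := by
      rcases ht with ht | ht <;> simp only [e, v, ht] <;> norm_num <;> linarith
    have hE : E s (t i) = s := by
      simp only [E, hes]; exact Set.projIcc_val _ _
    simp only [H, hE, hes]
    split_ifs with hs0
    · have : s = 0 := le_antisymm hs0 hs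
      subst this
      rw [h0, stretch_zero_left]
      rcases ht with ht | ht
      · rw [ht]; rfl
      · rw [ht, ← hf.periodic]; rfl
    · rfl
  have hne : ∀ s t j a, j ≠ i → H s (update t j a) =
      if e s (t i) ≤ 0 then f (update (update t i (stretch s (t i))) j a)
      else K (E s (t i)) (update t j a) := by
    intro s t j a hj
    simp only [H, update_of_ne (Ne.symm hj), update_comm (Ne.symm hj)]
  have hHP : ∀ (s : I) (k : C(I^N, X)), (∀ t, k t = H s t) → IsTorusMap x₀ S D k := by
    intro s k hk
    refine ⟨fun t j hj hjt => ?_, fun t j => ?_, fun t j hj a => ?_⟩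
    · rw [hk]
      simp only [H]
      split_ifs
      · refine hf.face _ j hj ?_
        rwa [update_of_ne (ne_of_mem_of_not_mem hj hi)]
      · exact face _ _ j hj hjt
    · rw [hk, hk]
      by_cases hji : j = i
      · subst hji
        rw [hside _ _ (by simp), hside _ _ (by simp), per]
      · rw [hne _ _ _ _ hji, hne _ _ _ _ hji, hf.periodic, per]
    · have hji : j ≠ i := fun e => hi' (e ▸ hj)
      rw [hk, hk, hne _ _ _ _ hji, hf.indep _ j hj, indep _ _ j (Finset.mem_insert_of_mem hj)]
  refine ⟨⟨fun t => H 1 t, hH.comp (by fun_prop : Continuous fun t : I^N => ((1 : I), t))⟩, ?_,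
    homotopicWith_of_continuous H hH (fun t => ?_) (fun t => rfl) hHP⟩
  · have hg := hHP 1 ⟨fun t => H 1 t, hH.comp (by fun_prop : Continuous fun t : I^N => ((1 : I), t))⟩
      fun _ => rfl
    refine ⟨fun t j hj hjt => ?_, hg.periodic, hg.indep⟩
    rcases Finset.mem_insert.1 hj with rfl | hj
    · exact (hside 1 t hjt).trans (h1 t)
    · exact hg.face t j hj hjt
  · have hu := (t i).2
    have : e 0 (t i) ≤ 0 := by
      simp only [e, v]; norm_num; exact ⟨hu.1, hu.2⟩
    simp only [H, this, if_true, stretch_zero_left, update_eq_self]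

/-- The face conditions in `S` are restored one direction at a time by `homotopicWith_const_insert`.
With `S₀` empty, a free contraction becomes a based one. -/
theorem homotopicWith_const_of_subset {x₀ : X} {S D : Finset N} (hSD : Disjoint S D)
    {f : C(I^N, X)} (hf : IsTorusMap x₀ S D f) {S₀ : Finset N} (hS : S₀ ⊆ S)
    (h : HomotopicWith f (.const _ x₀) (IsTorusMap x₀ S₀ D)) :
    HomotopicWith f (.const _ x₀) (IsTorusMap x₀ S D) := by
  suffices ∀ E : Finset N, E ⊆ S →
      HomotopicWith f (.const _ x₀) (IsTorusMap x₀ (E ∪ S₀) D) by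
    simpa [Finset.union_eq_left.2 hS] using this S subset_rfl
  intro E
  induction E using Finset.induction_on with
  | empty => intro _; simpa using h
  | insert a E ha ih =>
    intro hE
    have haS := hE (Finset.mem_insert_self a E)
    rw [Finset.insert_union]
    refine homotopicWith_const_insert (Finset.disjoint_left.1 hSD haS) (hf.mono ?_ subset_rfl)
      (ih ((Finset.subset_insert a E).trans hE))
    rw [← Finset.insert_union]
    exact Finset.union_subset hE hS

/-! ### Homotopy groups and faces of a cube -/

theorem subsingleton_homotopyGroup_iff {M : Type*} {x₀ : X} :
    Subsingleton (HomotopyGroup M X x₀) ↔ ∀ p : Ω^ M X x₀, GenLoop.Homotopic p GenLoop.const := by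
  constructor
  · intro h p
    exact Quotient.exact (h.elim (⟦p⟧ : HomotopyGroup M X x₀) ⟦GenLoop.const⟧)
  · intro h
    refine ⟨fun a b => ?_⟩
    induction a using Quotient.inductionOn with | _ p =>
    induction b using Quotient.inductionOn with | _ q =>
    exact Quotient.sound ((h p).trans (h q).symm)

/-- Periodicity is automatic for maps equal to x₀ on the whole boundary. -/
theorem homotopic_const_iff {M : Type*} [DecidableEq M] [Fintype M] {x₀ : X} {p : Ω^ M X x₀} :
    GenLoop.Homotopic p GenLoop.const ↔
      HomotopicWith p.1 (.const _ x₀) (IsTorusMap x₀ Finset.univ ∅) := by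
  constructor
  · intro h
    refine HomotopicWith.mono h fun k hk => ?_
    have hb : ∀ t i, t i = 0 ∨ t i = 1 → k t = x₀ := fun t i ht => by
      rw [hk t ⟨i, ht⟩, p.2 t ⟨i, ht⟩]
    refine ⟨fun t i _ => hb t i, fun t i => ?_, by simp⟩
    rw [hb _ i (by simp), hb _ i (by simp)]
  · intro h
    refine HomotopicWith.mono h fun k hk => ?_
    rintro t ⟨i, hi⟩
    rw [hk.face t i (Finset.mem_univ i) hi, p.2 t ⟨i, hi⟩]

theorem subsingleton_homotopyGroup_congr {M M' : Type*} (e : M ≃ M') {x₀ : X}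
    (h : Subsingleton (HomotopyGroup M X x₀)) : Subsingleton (HomotopyGroup M' X x₀) := by
  rw [subsingleton_homotopyGroup_iff] at h ⊢
  intro p
  have hp := h ((GenLoop.congr x₀ e).symm p)
  have := HomotopicWith.comp_right hp (⟨fun t m => t (e m), by fun_prop⟩ : C(I^M', I^M))
    (Q := fun k => ∀ t ∈ Cube.boundary M', k t = p.1 t) (fun k hk t ⟨i, hi⟩ => by
      have hb : (fun m => t (e m)) ∈ Cube.boundary M := ⟨e.symm i, by simpa using hi⟩
      rw [p.2 t ⟨i, hi⟩]
      refine (hk _ hb).trans ?_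
      exact ((GenLoop.congr x₀ e).symm p).2 _ hb)
  have he : ((GenLoop.congr x₀ e).symm p).1.comp (⟨fun t m => t (e m), by fun_prop⟩ : C(I^M', I^M))
      = p.1 := by
    ext t
    simp [GenLoop.congr]
  rw [he] at this
  exact this

/-- The inclusion of the cube on the coordinates in `S` as a face of a larger cube. -/
def extendZero (S : Finset N) : C(I^S, I^N) where
  toFun t i := if h : i ∈ S then t ⟨i, h⟩ else 0
  continuous_toFun := by
    refine continuous_pi fun i => ?_
    by_cases h : i ∈ S
    · simpa [h] using continuous_apply _
    · simpa [h] using continuous_const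

/-- The projection of a cube to the coordinates in `S`. -/
def restrictTo (S : Finset N) : C(I^N, I^S) := ⟨fun t i => t i, by fun_prop⟩

theorem restrictTo_update_of_mem {S : Finset N} (t : I^N) {i : N} (hi : i ∈ S) (a : I) :
    restrictTo S (update t i a) = update (restrictTo S t) ⟨i, hi⟩ a := by
  ext j
  by_cases hj : j = ⟨i, hi⟩
  · subst hj; simp [restrictTo]
  · have : (j : N) ≠ i := fun e => hj (Subtype.ext e)
    simp [restrictTo, hj, this]

theorem restrictTo_update_of_notMem {S : Finset N} (t : I^N) {i : N} (hi : i ∉ S) (a : I) :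
    restrictTo S (update t i a) = restrictTo S t := by
  ext j
  have : (j : N) ≠ i := ne_of_mem_of_not_mem j.2 hi
  simp [restrictTo, this]

theorem extendZero_update {S : Finset N} (t : I^S) (i : S) (a : I) :
    extendZero S (update t i a) = update (extendZero S t) i a := by
  ext j
  by_cases hj : j = i
  · subst hj; simp [extendZero]
  · by_cases hjS : j ∈ S
    · have : (⟨j, hjS⟩ : S) ≠ i := fun e => hj (congrArg Subtype.val e)
      simp [extendZero, hjS, hj, this]
    · simp [extendZero, hjS, hj]

theorem restrictTo_extendZero {S : Finset N} (t : I^S) : restrictTo S (extendZero S t) = t := by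
  ext i
  simp [extendZero, restrictTo]

theorem IsTorusMap.comp_restrictTo {x₀ : X} {S S₀ D : Finset N} {S' : Finset S} {k : C(I^S, X)}
    (hk : IsTorusMap x₀ S' ∅ k) (hSD : Disjoint S D)
    (hS : ∀ i ∈ S₀, ∃ h : i ∈ S, ⟨i, h⟩ ∈ S') : IsTorusMap x₀ S₀ D (k.comp (restrictTo S)) := by
  refine ⟨fun t i hi ht => ?_, fun t i => ?_, fun t i hi a => ?_⟩
  · obtain ⟨h, h'⟩ := hS i hi
    exact hk.face _ ⟨i, h⟩ h' ht
  · by_cases hi : i ∈ S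
    · simp only [ContinuousMap.comp_apply, restrictTo_update_of_mem t hi, hk.periodic]
    · simp only [ContinuousMap.comp_apply, restrictTo_update_of_notMem t hi]
  · simp only [ContinuousMap.comp_apply,
      restrictTo_update_of_notMem t (Finset.disjoint_right.1 hSD hi)]

theorem IsTorusMap.comp_extendZero {x₀ : X} {S S₀ D : Finset N} {S' : Finset S} {k : C(I^N, X)}
    (hk : IsTorusMap x₀ S₀ D k) (hS : ∀ i ∈ S', (i : N) ∈ S₀) :
    IsTorusMap x₀ S' ∅ (k.comp (extendZero S)) := by
  refine ⟨fun t i hi ht => ?_, fun t i => ?_, by simp⟩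
  · exact hk.face _ i (hS i hi) (by simpa [extendZero] using ht)
  · simp only [ContinuousMap.comp_apply, extendZero_update, hk.periodic]

/-- Such a map is determined by its restriction to the coordinates in `S`, which is a based sphere;
its contraction is pulled back along the projection. -/
theorem IsTorusMap.homotopicWith_const_of_union_eq_univ [Fintype N] {x₀ : X} {S D : Finset N}
    (hSD : Disjoint S D) (hu : S ∪ D = Finset.univ) {f : C(I^N, X)} (hf : IsTorusMap x₀ S D f)
    (h : Subsingleton (HomotopyGroup S X x₀)) :
    HomotopicWith f (.const _ x₀) (IsTorusMap x₀ S D) := by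
  rw [subsingleton_homotopyGroup_iff] at h
  have hp : ∀ t ∈ Cube.boundary S, f.comp (extendZero S) t = x₀ := by
    rintro t ⟨i, hi⟩
    refine hf.face _ i i.2 ?_
    simpa [extendZero] using hi
  have key := HomotopicWith.comp_right (homotopic_const_iff.1 (h ⟨_, hp⟩)) (restrictTo S)
    (Q := IsTorusMap x₀ S D) fun k hk => hk.comp_restrictTo hSD fun i hi => ⟨hi, by simp⟩
  have he : (f.comp (extendZero S)).comp (restrictTo S) = f := by
    ext t
    refine hf.apply_eq_of_eq_off fun i hi => ?_
    have : i ∈ S := by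
      have := Finset.mem_univ i
      rw [← hu, Finset.mem_union] at this
      tauto
    simp [extendZero, restrictTo, this]
  rw [he] at key
  exact key

/-! ### Consequences of vanishing homotopy groups -/

theorem IsTorusMap.homotopicWith_const [Fintype N] {x₀ : X} {S D : Finset N} (hSD : Disjoint S D)
    {f : C(I^N, X)} (hf : IsTorusMap x₀ S D f)
    (h : ∀ k, S.card ≤ k → k + D.card ≤ Fintype.card N → Subsingleton (π_ k X x₀)) :
    HomotopicWith f (.const _ x₀) (IsTorusMap x₀ S D) := by
  -- Induction on the number of directions in neither `S` nor `D`. A free direction i is used twice: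
  -- the face t_i = 0 moves i into `D`, and once the faces are constant, i moves into `S`. The two
  -- moves trim the range of k at its upper and lower end respectively.
  induction hn : ((S ∪ D)ᶜ).card generalizing S D f with
  | zero =>
    have hu : S ∪ D = Finset.univ := by
      rwa [Finset.card_eq_zero, Finset.compl_eq_empty_iff] at hn
    refine hf.homotopicWith_const_of_union_eq_univ hSD hu ?_
    refine subsingleton_homotopyGroup_congr (S.equivFin).symm (h S.card le_rfl ?_)
    rw [← Finset.card_union_of_disjoint hSD, hu, Finset.card_univ]
  | succ n ih =>
    obtain ⟨i, hi⟩ := Finset.card_pos.1 (by omega : 0 < ((S ∪ D)ᶜ).card)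
    rw [Finset.mem_compl, Finset.mem_union, not_or] at hi
    have hc : ((insert i (S ∪ D))ᶜ).card = n := by
      rw [Finset.compl_insert, Finset.card_erase_of_mem (by simp [hi]), hn]
      rfl
    have hface := ih (S := S) (D := insert i D)
      (Finset.disjoint_insert_right.2 ⟨hi.1, hSD⟩) (hf.faceZero hi.1)
      (fun k hk hk' => h k hk (by
        rw [Finset.card_insert_of_notMem hi.2] at hk'; omega))
      (by rwa [Finset.union_insert])
    obtain ⟨g, hg, hfg⟩ := exists_homotopicWith_insert hi.1 hi.2 hf hface
    have hg' := ih (S := insert i S) (D := D)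
      (Finset.disjoint_insert_left.2 ⟨hi.2, hSD⟩) hg
      (fun k hk hk' => h k (by
        rw [Finset.card_insert_of_notMem hi.1] at hk; omega) hk')
      (by rwa [Finset.insert_union])
    exact hfg.trans (hg'.mono fun k hk => hk.mono (Finset.subset_insert _ _) subset_rfl)

theorem IsTorusMap.exists_homotopicWith_univ [Fintype N] {x₀ : X} {S₀ : Finset N}
    {f : C(I^N, X)} (hf : IsTorusMap x₀ S₀ ∅ f)
    (h : ∀ k, S₀.card ≤ k → k < Fintype.card N → Subsingleton (π_ k X x₀)) :
    ∃ g, IsTorusMap x₀ Finset.univ ∅ g ∧ HomotopicWith f g (IsTorusMap x₀ S₀ ∅) := by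
  suffices ∀ E : Finset N,
      ∃ g, IsTorusMap x₀ (E ∪ S₀) ∅ g ∧ HomotopicWith f g (IsTorusMap x₀ S₀ ∅) by
    have hu := this Finset.univ
    rwa [Finset.union_eq_left.2 (Finset.subset_univ S₀)] at hu
  intro E
  induction E using Finset.induction_on with
  | empty => exact ⟨f, by simpa using hf, HomotopicWith.refl f hf⟩
  | insert a E ha ih =>
    obtain ⟨g, hg, hfg⟩ := ih
    rw [Finset.insert_union]
    by_cases haS : a ∈ E ∪ S₀
    · rw [Finset.insert_eq_of_mem haS]
      exact ⟨g, hg, hfg⟩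
    -- The face does not depend on coordinate `a`, so only k below the dimension of the cube is
    -- needed.
    have hface := (hg.faceZero haS).homotopicWith_const
      (Finset.disjoint_insert_right.2 ⟨haS, Finset.disjoint_empty_right _⟩) (fun k hk hk' => by
        refine h k ((Finset.card_le_card Finset.subset_union_right).trans hk) ?_
        simp at hk'
        omega)
    obtain ⟨g', hg', hgg'⟩ := exists_homotopicWith_insert haS (Finset.notMem_empty a) hg hface
    exact ⟨g', hg', hfg.trans (hgg'.mono fun k hk => hk.mono Finset.subset_union_right subset_rfl)⟩

end Cube

/-! ### Loops of torus maps as periodic maps of a cube -/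

section Unfolding

variable {X : Type*} [TopologicalSpace X]

theorem coe_zero_eq_coe_one : (((0 : I) : ℝ) : UnitAddCircle) = (((1 : I) : ℝ) : UnitAddCircle) := by
  simpa using (AddCircle.coe_period (1 : ℝ)).symm

theorem eq_or_endpoints_of_coe_eq {a b : I}
    (h : ((a : ℝ) : UnitAddCircle) = ((b : ℝ) : UnitAddCircle)) :
    a = b ∨ ((a = 0 ∨ a = 1) ∧ (b = 0 ∨ b = 1)) := by
  by_cases hab : a = b
  · exact Or.inl hab
  right
  -- This is the boundary statement for the one-dimensional cube.
  have key : ∀ {c d : I}, ((c : ℝ) : UnitAddCircle) = ((d : ℝ) : UnitAddCircle) → c ≠ d →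
      c = 0 ∨ c = 1 := fun {c d} hcd hne => by
    obtain ⟨_, hi⟩ := mem_boundary_of_cubeToTorus_eq (N := Unit) (s := fun _ => c)
      (t := fun _ => d) (funext fun _ => hcd) fun e => hne (congrFun e ())
    exact hi
  exact ⟨key h hab, key h.symm (Ne.symm hab)⟩

theorem apply_eq_of_cubeToTorus_eq {M : Type} [Finite M] [DecidableEq M] {Y : Type*}
    {f : (I^M) → Y}
    (hf : ∀ t i, f (update t i 0) = f (update t i 1)) {s t : I^M}
    (h : cubeToTorus M s = cubeToTorus M t) : f s = f t := by
  refine apply_eq_of_update (f := f)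
    (R := fun _ a b => ((a : ℝ) : UnitAddCircle) = ((b : ℝ) : UnitAddCircle))
    (fun t i a b hab => ?_) (congrFun h)
  rcases eq_or_endpoints_of_coe_eq hab with rfl | ⟨rfl | rfl, rfl | rfl⟩
  · rfl
  · rfl
  · exact hf t i
  · exact (hf t i).symm
  · rfl

/-- The lift is continuous in the parameter because the preimage in the cube of a compact subset of
the torus is compact. -/
theorem exists_torus_lift {A : Type*} [TopologicalSpace A] {M : Type} [Finite M] [DecidableEq M]
    (h : C(A, C(I^M, X))) (hper : ∀ a t i, h a (update t i 0) = h a (update t i 1)) :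
    ∃ g : C(A, C(Torus M, X)), ∀ a t, g a (cubeToTorus M t) = h a t := by
  let g : A → C(Torus M, X) := fun a => (isQuotientMap_cubeToTorus M).lift (h a)
    fun s t hst => apply_eq_of_cubeToTorus_eq (hper a) hst
  have hg : ∀ a, (g a).comp (cubeToTorus M) = h a := fun a =>
    (isQuotientMap_cubeToTorus M).lift_comp _ _
  refine ⟨⟨g, ContinuousMap.continuous_compactOpen.2 fun K hK U hU => ?_⟩, fun a t =>
    ContinuousMap.congr_fun (hg a) t⟩
  convert (ContinuousMap.isOpen_setOfPred_mapsTo (Y := X)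
    (hK.isClosed.preimage (cubeToTorus M).continuous).isCompact hU).preimage h.continuous using 1
  ext a
  constructor
  · intro ha s hs
    rw [← hg]
    exact ha hs
  · intro ha z hz
    obtain ⟨s, rfl⟩ := cubeToTorus_surjective M z
    have := ha hz
    rwa [← hg] at this

section Unfold

variable {m : ℕ} {x₀ : X}

/-- A path of maps of a torus, seen as a map of a cube. -/
def unfold (p : C(I, C(Torus (Fin m), X))) : C(I^(Fin (m + 1)), X) :=
  ⟨fun t => p (t 0) (cubeToTorus (Fin m) fun j => t j.succ), by fun_prop⟩

theorem unfold_apply (p : C(I, C(Torus (Fin m), X))) (t : I^(Fin (m + 1))) :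
    unfold p t = p (t 0) (cubeToTorus (Fin m) fun j => t j.succ) := rfl

theorem isTorusMap_unfold {p : C(I, C(Torus (Fin m), X))} (h0 : p 0 = .const _ x₀)
    (h1 : p 1 = .const _ x₀) : IsTorusMap x₀ {0} ∅ (unfold p) := by
  have hface : ∀ t : I^(Fin (m + 1)), t 0 = 0 ∨ t 0 = 1 → unfold p t = x₀ := by
    rintro t (ht | ht) <;> simp [unfold_apply, ht, h0, h1]
  refine ⟨fun t i hi ht => ?_, fun t i => ?_, by simp⟩
  · rw [Finset.mem_singleton] at hi
    subst hi
    exact hface t ht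
  · cases i using Fin.cases with
    | zero => rw [hface _ (by simp), hface _ (by simp)]
    | succ j =>
      simp only [unfold_apply]
      rw [update_of_ne (Fin.succ_ne_zero j).symm, update_of_ne (Fin.succ_ne_zero j).symm]
      congr 1
      ext k
      by_cases hk : k = j
      · subst hk
        simpa [cubeToTorus_apply] using coe_zero_eq_coe_one
      · simp [cubeToTorus_apply, hk]

/-- The parameter space `A` is a point for refolding one map and `I` for refolding a homotopy. -/
theorem exists_unfold_family {A : Type*} [TopologicalSpace A] (H : A → (I^(Fin (m + 1))) → X)
    (hH : Continuous fun q : A × (I^(Fin (m + 1))) => H q.1 q.2)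
    (hper : ∀ a t i, H a (update t i 0) = H a (update t i 1)) :
    ∃ g : C(A × I, C(Torus (Fin m), X)),
      ∀ a r u, g (a, r) (cubeToTorus (Fin m) u) = H a (Fin.cons r u) := by
  let F : C((A × I) × (I^(Fin m)), X) :=
    ⟨fun q => H q.1.1 (Fin.cons q.1.2 q.2 : I^(Fin (m + 1))), by
      refine hH.comp (g := fun q : A × (I^(Fin (m + 1))) => H q.1 q.2)
        ((continuous_fst.comp continuous_fst).prodMk (continuous_pi fun i => ?_))
      cases i using Fin.cases with
      | zero => exact continuous_snd.comp continuous_fst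
      | succ j => exact (continuous_apply j).comp continuous_snd⟩
  obtain ⟨g, hg⟩ := exists_torus_lift F.curry fun a t i => by
    change H _ (Fin.cons _ _) = H _ (Fin.cons _ _)
    rw [Fin.cons_update, Fin.cons_update]
    exact hper _ _ _
  exact ⟨g, fun a r u => hg (a, r) u⟩

theorem IsTorusMap.exists_unfold_eq {f : C(I^(Fin (m + 1)), X)} (hf : IsTorusMap x₀ {0} ∅ f) :
    ∃ p : Path (ContinuousMap.const (Torus (Fin m)) x₀) (.const _ x₀),
      unfold p.toContinuousMap = f := by
  obtain ⟨g, hg⟩ := exists_unfold_family (A := Unit) (fun _ => f) (by fun_prop)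
    fun _ => hf.periodic
  have hend : ∀ r, r = 0 ∨ r = 1 → g ((), r) = .const _ x₀ := by
    intro r hr
    ext z
    obtain ⟨u, rfl⟩ := cubeToTorus_surjective _ z
    rw [hg]
    exact hf.face _ 0 (by simp) (by simpa using hr)
  refine ⟨⟨⟨fun r => g ((), r), by fun_prop⟩, hend 0 (Or.inl rfl), hend 1 (Or.inr rfl)⟩, ?_⟩
  ext t
  refine (hg () (t 0) _).trans (congrArg f ?_)
  exact Fin.cons_self_tail t

theorem path_homotopic_iff {p q : Path (ContinuousMap.const (Torus (Fin m)) x₀) (.const _ x₀)} :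
    p.Homotopic q ↔ HomotopicWith (unfold p.toContinuousMap) (unfold q.toContinuousMap)
      (IsTorusMap x₀ {0} ∅) := by
  constructor
  · rintro ⟨F⟩
    refine homotopicWith_of_continuous
      (fun s t => F (s, t 0) (cubeToTorus (Fin m) fun j => t j.succ)) (by fun_prop)
      (fun t => ?_) (fun t => ?_) fun s h hh => ?_
    · simp [unfold_apply]
    · simp [unfold_apply]
    · have : h = unfold ⟨fun r => F (s, r), by fun_prop⟩ := by
        ext t
        rw [hh]; rfl
      rw [this]
      exact isTorusMap_unfold (F.source s) (F.target s)
  · intro h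
    obtain ⟨H, hH, h0, h1, hP⟩ := h.exists_map
    obtain ⟨g, hg⟩ := exists_unfold_family H hH fun s t i => by
      obtain ⟨k, hk, hk'⟩ := hP s
      rw [← hk, ← hk]; exact hk'.periodic t i
    have hend : ∀ s r, r = 0 ∨ r = 1 → g (s, r) = .const _ x₀ := by
      intro s r hr
      ext z
      obtain ⟨u, rfl⟩ := cubeToTorus_surjective _ z
      obtain ⟨k, hk, hk'⟩ := hP s
      rw [hg, ← hk]
      exact hk'.face _ 0 (by simp) (by simpa using hr)
    refine ⟨⟨⟨g, fun r => ?_, fun r => ?_⟩, fun s r hr => ?_⟩⟩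
    · ext z
      obtain ⟨u, rfl⟩ := cubeToTorus_surjective _ z
      exact (hg 0 r u).trans ((h0 _).trans (by simp [unfold_apply]))
    · ext z
      obtain ⟨u, rfl⟩ := cubeToTorus_surjective _ z
      exact (hg 1 r u).trans ((h1 _).trans (by simp [unfold_apply]))
    · refine (hend s r hr).trans ?_
      rcases hr with rfl | rfl
      · exact p.source.symm
      · exact p.target.symm

end Unfold

/-! ### The canonical homomorphism -/

theorem isTorusMap_genLoop {M : Type*} [DecidableEq M] [Fintype M] {x₀ : X} (p : Ω^ M X x₀) :
    IsTorusMap x₀ Finset.univ ∅ p.1 := by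
  refine ⟨fun t i _ ht => p.2 t ⟨i, ht⟩, fun t i => ?_, by simp⟩
  rw [p.2 _ ⟨i, by simp⟩, p.2 _ ⟨i, by simp⟩]

/-- On the level of cube maps the canonical homomorphism is the identity: it only forgets face
conditions. -/
theorem piToTau_mk (m : ℕ) (x₀ : X) (p : Ω^ (Fin (m + 1)) X x₀) :
    ∃ γ : Path (ContinuousMap.const (Torus (Fin m)) x₀) (.const _ x₀),
      piToTau m X x₀ ⟦p⟧ = FundamentalGroup.fromPath (Path.Homotopic.Quotient.mk γ) ∧
        unfold γ.toContinuousMap = p.1 := by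
  refine ⟨((GenLoop.toLoop 0 p).map (loopsToTorusMaps m X x₀).continuous).cast
    (loopsToTorusMaps_const m X x₀).symm (loopsToTorusMaps_const m X x₀).symm, ?_, ?_⟩
  · exact FundamentalGroup.mapOfEq_apply (loopsToTorusMaps m X x₀) (loopsToTorusMaps_const m X x₀)
      (piEquivPi1GenLoop m X x₀ ⟦p⟧)
  · ext t
    refine (genLoopToTorusMap_apply (GenLoop.congr x₀ (finSuccAboveEquiv (0 : Fin (m + 1))).symm
      (GenLoop.toLoop 0 p (t 0))) fun j => t j.succ).trans ?_
    change p _ = p _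
    congr 1
    ext i
    cases i using Fin.cases with
    | zero => simp
    | succ j =>
      have : (finSuccAboveEquiv (0 : Fin (m + 1))).symm ⟨j.succ, Fin.succ_ne_zero j⟩ = j :=
        (Equiv.symm_apply_eq _).2 (Subtype.ext rfl)
      simp [this]

theorem piToTau_injective (m : ℕ) (x₀ : X) : Injective (piToTau m X x₀) := by
  refine (injective_iff_map_eq_one _).2 fun a ha => ?_
  induction a using Quotient.inductionOn with | _ p =>
  obtain ⟨γ, hγ, hu⟩ := piToTau_mk m x₀ p
  obtain ⟨γ₁, hγ₁, hu₁⟩ := piToTau_mk m x₀ GenLoop.const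
  have h1 : γ.Homotopic γ₁ := by
    refine Path.Homotopic.Quotient.exact ?_
    refine (hγ.symm.trans ha).trans (Eq.trans ?_ hγ₁)
    exact (map_one _).symm
  rw [path_homotopic_iff, hu, hu₁] at h1
  have h2 : GenLoop.Homotopic p GenLoop.const := homotopic_const_iff.2 <|
    homotopicWith_const_of_subset (Finset.disjoint_empty_right _)
      (isTorusMap_genLoop p) (Finset.subset_univ {0}) h1
  exact Quotient.sound h2

theorem piToTau_surjective (m : ℕ) (x₀ : X)
    (h : ∀ k, 1 ≤ k → k ≤ m → Subsingleton (π_ k X x₀)) : Surjective (piToTau m X x₀) := by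
  intro a
  obtain ⟨γ, rfl⟩ : ∃ γ, FundamentalGroup.fromPath (Path.Homotopic.Quotient.mk γ) = a :=
    Quotient.exists_rep a
  obtain ⟨g, hg, hγg⟩ := (isTorusMap_unfold γ.source γ.target).exists_homotopicWith_univ
    fun k hk hk' => h k (by simpa using hk) (by simpa [Nat.lt_succ_iff] using hk')
  have hgb : ∀ t ∈ Cube.boundary (Fin (m + 1)), g t = x₀ := by
    rintro t ⟨i, hi⟩
    exact hg.face t i (Finset.mem_univ i) hi
  obtain ⟨γ', hγ', hu⟩ := piToTau_mk m x₀ ⟨g, hgb⟩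
  refine ⟨⟦⟨g, hgb⟩⟧, hγ'.trans ?_⟩
  refine Quotient.sound (path_homotopic_iff.2 ?_)
  rw [hu]
  exact hγg.symm

theorem subsingleton_homotopyGroup_of_piToTau_surjective {m : ℕ} {x₀ : X}
    (h : Surjective (piToTau m X x₀)) {k : ℕ} (hk : 1 ≤ k) (hkm : k ≤ m) :
    Subsingleton (π_ k X x₀) := by
  -- The first k coordinates: 0 is among them since k ≥ 1, the last is not since k ≤ m.
  let S : Finset (Fin (m + 1)) := Finset.univ.filter fun i => (i : ℕ) < k
  have hcard : S.card = k := by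
    rw [Fin.card_filter_val_lt]; omega
  have h0 : (0 : Fin (m + 1)) ∈ S := by simp [S]; omega
  have hl : Fin.last m ∉ S := by simp [S]; omega
  refine subsingleton_homotopyGroup_congr (S.equivFinOfCardEq hcard)
    (subsingleton_homotopyGroup_iff.2 fun p => ?_)
  have hdisj : Disjoint S Sᶜ := disjoint_compl_right
  let f : C(I^(Fin (m + 1)), X) := p.1.comp (restrictTo S)
  have hf : IsTorusMap x₀ S Sᶜ f :=
    (isTorusMap_genLoop p).comp_restrictTo hdisj fun i hi => ⟨hi, by simp⟩
  have hS0 : {0} ⊆ S := by simpa using h0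
  obtain ⟨γ, hγ⟩ := (hf.mono hS0 (Finset.empty_subset _)).exists_unfold_eq
  obtain ⟨b, hb⟩ := h (FundamentalGroup.fromPath (Path.Homotopic.Quotient.mk γ))
  induction b using Quotient.inductionOn with | _ q =>
  obtain ⟨γ', hγ', hu⟩ := piToTau_mk m x₀ q
  have hfq : HomotopicWith f q.1 (IsTorusMap x₀ {0} ∅) := by
    rw [← hγ, ← hu]
    exact path_homotopic_iff.1 (Path.Homotopic.Quotient.exact (hb.symm.trans hγ'))
  -- Composing with the retraction onto the face where the coordinates outside `S` vanish fixes `f`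
  -- and makes `q` constant, since that face lies in the boundary.
  have hfr := HomotopicWith.comp_right hfq ((extendZero S).comp (restrictTo S))
    (Q := IsTorusMap x₀ {0} Sᶜ) fun k hk => by
      rw [← ContinuousMap.comp_assoc]
      refine (hk.comp_extendZero (S' := {⟨0, h0⟩}) (by simp)).comp_restrictTo hdisj ?_
      simp [h0]
  have hf1 : f.comp ((extendZero S).comp (restrictTo S)) = f := by
    ext t
    simp [f, restrictTo_extendZero]
  have hq1 : q.1.comp ((extendZero S).comp (restrictTo S)) = .const _ x₀ := by
    ext t
    refine q.2 _ ⟨Fin.last m, Or.inl ?_⟩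
    simp [extendZero, hl]
  rw [hf1, hq1] at hfr
  have hfc := homotopicWith_const_of_subset hdisj hf hS0 hfr
  have hp := HomotopicWith.comp_right hfc (extendZero S) (Q := IsTorusMap x₀ Finset.univ ∅)
    fun k hk => hk.comp_extendZero fun i _ => i.2
  have hfp : f.comp (extendZero S) = p.1 := by
    ext t
    simp [f, restrictTo_extendZero]
  rw [hfp] at hp
  exact homotopic_const_iff.2 hp

/-! ### Change of base point -/

/-- Sweeping the boundary of a cube along a path, by stretching the cube. -/
theorem exists_genLoop_homotopicWith {M : Type*} [Fintype M] [DecidableEq M] {x y : X}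
    (γ : Path x y) (p : Ω^ M X x) (z : X) :
    ∃ q : Ω^ M X y, HomotopicWith p.1 q.1 (IsTorusMap z ∅ ∅) := by
  -- `r` is the sup-distance from the centre, equal to 1/2 on the boundary. Stretching multiplies it
  -- by 1 + 2s, so `e` is the distance by which the stretched point overshoots the cube; it is `s`
  -- on the boundary.
  let r : (I^M) → ℝ := fun t => ‖fun i => (t i : ℝ) - 1 / 2‖
  have hr : Continuous r := by fun_prop
  have hr_le : ∀ t, r t ≤ 1 / 2 := fun t => (pi_norm_le_iff_of_nonneg (by norm_num)).2 fun i => by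
    rw [Real.norm_eq_abs, abs_le]
    have := (t i).2
    constructor <;> linarith [this.1, this.2]
  have hr_bd : ∀ t ∈ Cube.boundary M, r t = 1 / 2 := by
    rintro t ⟨i, hi⟩
    refine le_antisymm (hr_le t) (le_trans ?_ (norm_le_pi_norm _ i))
    rcases hi with hi | hi <;> rw [hi] <;> norm_num [abs_of_pos]
  let e : I → (I^M) → ℝ := fun s t => (1 + 2 * s) * r t - 1 / 2
  have he : Continuous fun q : I × (I^M) => e q.1 q.2 := by fun_prop
  let H : I → (I^M) → X := fun s t => if e s t ≤ 0 then p.1 (fun i => stretch s (t i))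
    else γ (Set.projIcc 0 1 zero_le_one (e s t))
  have hst := continuous_stretch
  have hH : Continuous fun q : I × (I^M) => H q.1 q.2 := by
    refine Continuous.if_le ?_ ?_ he continuous_const ?_
    · exact p.1.continuous.comp (continuous_pi fun i =>
        hst.comp (f := fun q : I × (I^M) => (q.1, q.2 i)) (by fun_prop))
    · exact γ.continuous.comp (continuous_projIcc.comp he)
    · rintro ⟨s, t⟩ hq
      simp only at hq ⊢
      rw [hq, Set.projIcc_left]
      refine (p.2 _ ?_).trans γ.source.symm
      by_contra hb
      have hs : (0 : ℝ) < 1 + 2 * s := by linarith [s.2.1]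
      have hlt : r t < 1 / 2 / (1 + 2 * s) := by
        refine (pi_norm_lt_iff (by positivity)).2 fun i => ?_
        rw [Real.norm_eq_abs, lt_div_iff₀ hs, ← abs_of_pos hs, ← abs_mul, abs_lt]
        constructor
        · by_contra hc
          exact hb ⟨i, Or.inl (Set.projIcc_of_le_left _ (by linarith))⟩
        · by_contra hc
          exact hb ⟨i, Or.inr (Set.projIcc_of_right_le _ (by linarith))⟩
      rw [lt_div_iff₀ hs] at hlt
      simp only [e] at hq
      linarith
  have hbd : ∀ s, ∀ t ∈ Cube.boundary M, H s t = γ s := by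
    intro s t ht
    have hes : e s t = s := by simp only [e, hr_bd t ht]; ring
    simp only [H, hes, Set.projIcc_val]
    split_ifs with hs
    · have : s = 0 := le_antisymm hs s.2.1
      subst this
      simp only [stretch_zero_left]
      exact (p.2 t ht).trans γ.source.symm
    · rfl
  refine ⟨⟨⟨H 1, hH.comp (by fun_prop : Continuous fun t : I^M => ((1 : I), t))⟩,
    fun t ht => (hbd 1 t ht).trans γ.target⟩, homotopicWith_of_continuous H hH (fun t => ?_)
      (fun _ => rfl) fun s k hk => ⟨by simp, fun t i => ?_, by simp⟩⟩
  · have : e 0 t ≤ 0 := by simpa [e] using hr_le t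
    simp only [H, this, if_true, stretch_zero_left]
  · rw [hk, hk, hbd _ _ ⟨i, by simp⟩, hbd _ _ ⟨i, by simp⟩]

theorem subsingleton_homotopyGroup_of_path {M : Type*} [Fintype M] [DecidableEq M] {x y : X}
    (γ : Path x y) (h : Subsingleton (HomotopyGroup M X y)) :
    Subsingleton (HomotopyGroup M X x) := by
  rw [subsingleton_homotopyGroup_iff] at h ⊢
  intro p
  obtain ⟨q, hq⟩ := exists_genLoop_homotopicWith γ p x
  have hqc : HomotopicWith q.1 (.const _ y) (IsTorusMap x ∅ ∅) :=
    (homotopic_const_iff.1 (h q)).mono fun k hk => ⟨by simp, hk.periodic, by simp⟩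
  -- With no face conditions imposed, the constant map at y may slide back along γ to x.
  have hc : HomotopicWith (.const _ y) (.const _ x) (IsTorusMap x (∅ : Finset M) ∅) :=
    homotopicWith_of_continuous (fun s _ => γ.symm s) (by fun_prop) (by simp) (by simp)
      fun s k hk => ⟨by simp, fun t i => by rw [hk, hk], by simp⟩
  exact homotopic_const_iff.2 <| homotopicWith_const_of_subset (Finset.disjoint_empty_right _)
    (isTorusMap_genLoop p) (Finset.empty_subset _) ((hq.trans hqc).trans hc)

theorem piToTau_bijective_iff (m : ℕ) (x₀ : X) : Bijective (piToTau m X x₀) ↔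
    ∀ k : ℕ, 1 ≤ k → k ≤ m → Subsingleton (π_ k X x₀) :=
  ⟨fun h _ hk hkm => subsingleton_homotopyGroup_of_piToTau_surjective h.2 hk hkm,
    fun h => ⟨piToTau_injective m x₀, piToTau_surjective m x₀ h⟩⟩

end Unfolding

end Fox

end

theorem proposition1 {X : Type*} [TopologicalSpace X] (x₀ : X) :
    (∀ n : ℕ,
      (∀ k : ℕ, 1 ≤ k → k ≤ n → Subsingleton (Fox.TorusHomotopyGroup k X x₀)) ↔
        (∀ k : ℕ, 1 ≤ k → k ≤ n → Subsingleton (HomotopyGroup.Pi k X x₀))) ∧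
    (∀ m : ℕ,
      (Function.Bijective (Fox.piToTau m X x₀) ↔
        ∀ k : ℕ, 1 ≤ k → k ≤ m → Subsingleton (HomotopyGroup.Pi k X x₀)) ∧
      (PathConnectedSpace X →
        (Function.Bijective (Fox.piToTau m X x₀) ↔ Fox.IsNConnected m X))) := by
  refine ⟨fun n => ⟨fun h k hk hkn => ?_, fun h k hk hkn => ?_⟩, fun m =>
    ⟨Fox.piToTau_bijective_iff m x₀, fun hX => ?_⟩⟩
  · obtain ⟨m, rfl⟩ : ∃ m, k = m + 1 := ⟨k - 1, by omega⟩
    have := h (m + 1) hk hkn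
    -- Injectivity needs no vanishing, so triviality of τ in this single degree is enough.
    exact (Fox.piToTau_injective m x₀).subsingleton
  · obtain ⟨m, rfl⟩ : ∃ m, k = m + 1 := ⟨k - 1, by omega⟩
    have := h (m + 1) hk hkn
    exact (Fox.piToTau_surjective m x₀ fun k hk hkm => h k hk (by omega)).subsingleton
  · rw [Fox.piToTau_bijective_iff]
    refine ⟨fun h => ⟨hX, fun x k hk hkm => ?_⟩, fun h => h.2 x₀⟩
    exact Fox.subsingleton_homotopyGroup_of_path (PathConnectedSpace.somePath x x₀) (h k hk hkm)
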